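/- Let $n,q\ge 0$ be integers, $\mathbf X\in\mathbb R^{n\times q}$, and let $\sigma\in\mathbb R$ and $\beta\ge 0$ be such that $\mathbf X\mathbf X^T+\sigma^2\mathbf I$ and $\mathbf X\mathbf X^T+\beta\mathbf I$ are positive definite (automatic if $\sigma\neq 0$, $\beta>0$). For a positive definite $n\times n$ matrix $\mathbf M$ and real $\rho>n-1$, let $\mathcal W(\mathbf M,\rho)$ be the Wishart distribution with scale $\mathbf M$ and $\rho$ degrees of freedom, i.e. the probability law on positive definite matrices with density proportional to $|\mathbf S|^{(\rho-n-1)/2}\exp(-\tfrac12\mathrm{tr}(\mathbf M^{-1}\mathbf S))$ with respect to Lebesgue measure $\prod_{i\le j}d\mathbf S_{ij}$ on symmetric matrices, and let $\mathcal W^{-1}(\mathbf M,\rho)$ be the inverse-Wishart distribution, i.e. the law of $\mathbf T^{-1}$ for $\mathbf T\sim\mathcal W(\mathbf M^{-1},\rho)$. (1) In the PCA-esque model $$\mathbf y\mid\mathbf S\sim\mathcal N\big(\mathbf 0,\tfrac1\rho\mathbf S\big),\qquad \mathbf S\sim\mathcal W(\mathbf X\mathbf X^T+\sigma^2\mathbf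 I,\rho),$$ the marginal law of the data column $\mathbf y\in\mathbb R^n$ converges weakly, as $\rho\to\infty$ through the reals, to $\mathcal N(\mathbf 0,\mathbf X\mathbf X^T+\sigma^2\mathbf I)$. (2) In the MCA-esque model $$\mathbf y\mid\mathbf S\sim\mathcal N\big(\mathbf 0,(\rho-n+1)\mathbf S\big),\qquad \mathbf S\sim\mathcal W^{-1}(\mathbf X\mathbf X^T+\beta\mathbf I,\rho),$$ the marginal law of $\mathbf y$ converges weakly, as $\rho\to\infty$ through the reals, to $\mathcal N(\mathbf 0,\mathbf X\mathbf X^T+\beta\mathbf I)$. (So both limits coincide when the noise levels $\beta$ and $\sigma^2$ are the same.) Moreover each limit $\mathcal N(\mathbf 0,\mathbf X\mathbf X^T+v\mathbf I)$ ($v=\sigma^2$, resp. $v=\beta$) is a noisy Gaussian process with linear kernel: it is the law of $(f(\mathbf x_i)+\varepsilon_i)_{i=1}^n$, where $\mathbf x_i$ is the $i$-th row of $\mathbf X$, $f$ is a centred Gaussian process on $\mathbb R^q$ with covariance $k(\mathbf x,\mathbf x')=\langle\mathbf x,\mathbf x'\rangle$, and $\varepsilon\sim\mathcal N(\mathbf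 0,v\mathbf I)$ is independent of $f$. -/

import Mathlib

open MeasureTheory ProbabilityTheory Filter Topology Matrix
open scoped ENNReal

noncomputable section

namespace ProbDR

/-- The (product) Borel sigma-algebra on real matrices. -/
instance matrixMeasurableSpace (n : ℕ) : MeasurableSpace (Matrix (Fin n) (Fin n) ℝ) :=
  inferInstanceAs (MeasurableSpace (Fin n → Fin n → ℝ))

instance matrixBorelSpace (n : ℕ) : BorelSpace (Matrix (Fin n) (Fin n) ℝ) :=
  inferInstanceAs (BorelSpace (Fin n → Fin n → ℝ))

/-- The symmetric matrix with prescribed entries on and above the diagonal. -/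
def symmOfUpper (n : ℕ) (u : {p : Fin n × Fin n // p.1 ≤ p.2} → ℝ) :
    Matrix (Fin n) (Fin n) ℝ :=
  Matrix.of fun i j =>
    if h : i ≤ j then u ⟨(i, j), h⟩ else u ⟨(j, i), (not_le.mp h).le⟩

/-- Lebesgue measure on the space of real symmetric `n × n` matrices, `∏_{i ≤ j} dS_{ij}`,
viewed as a measure on all matrices. -/
def symmVolume (n : ℕ) : Measure (Matrix (Fin n) (Fin n) ℝ) :=
  (volume : Measure ({p : Fin n × Fin n // p.1 ≤ p.2} → ℝ)).map (symmOfUpper n)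

/-- The unnormalised Wishart density with scale matrix `M` and `ρ` degrees of freedom,
`|S|^{(ρ-n-1)/2} exp(-tr(M⁻¹ S)/2)` on the cone of positive definite matrices. -/
def wishartDensity {n : ℕ} (M : Matrix (Fin n) (Fin n) ℝ) (ρ : ℝ) :
    Matrix (Fin n) (Fin n) ℝ → ℝ≥0∞ :=
  Set.indicator {S | S.PosDef} fun S =>
    ENNReal.ofReal (S.det ^ ((ρ - n - 1) / 2) * Real.exp (-(M⁻¹ * S).trace / 2))

/-- The Wishart distribution `W(M, ρ)`, for a positive definite `M` and real `ρ > n - 1`: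
the law whose density with respect to Lebesgue measure on symmetric matrices is proportional
to `wishartDensity M ρ` (with mean `ρ M`). -/
def wishart {n : ℕ} (M : Matrix (Fin n) (Fin n) ℝ) (ρ : ℝ) :
    Measure (Matrix (Fin n) (Fin n) ℝ) :=
  ((symmVolume n).withDensity (wishartDensity M ρ) Set.univ)⁻¹ •
    (symmVolume n).withDensity (wishartDensity M ρ)

/-- The inverse-Wishart distribution `W⁻¹(Ψ, ρ)`: the law of `T⁻¹` for `T ∼ W(Ψ⁻¹, ρ)`. -/
def invWishart {n : ℕ} (Ψ : Matrix (Fin n) (Fin n) ℝ) (ρ : ℝ) :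
    Measure (Matrix (Fin n) (Fin n) ℝ) :=
  (wishart Ψ⁻¹ ρ).map fun T => T⁻¹

instance sFinite_wishart {n : ℕ} (M : Matrix (Fin n) (Fin n) ℝ) (ρ : ℝ) :
    SFinite (wishart M ρ) := by
  unfold wishart symmVolume
  infer_instance

instance sFinite_invWishart {n : ℕ} (Ψ : Matrix (Fin n) (Fin n) ℝ) (ρ : ℝ) :
    SFinite (invWishart Ψ ρ) := by
  unfold invWishart
  infer_instance

theorem measurable_inv_matrix (n : ℕ) :
    Measurable fun T : Matrix (Fin n) (Fin n) ℝ => T⁻¹ := by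
  have h1 : Measurable fun T : Matrix (Fin n) (Fin n) ℝ => T.det :=
    (Continuous.matrix_det continuous_id).measurable
  have h2 : Measurable fun T : Matrix (Fin n) (Fin n) ℝ => T.adjugate :=
    (Continuous.matrix_adjugate continuous_id).measurable
  simp only [Matrix.inv_def, Ring.inverse_eq_inv']
  exact h1.inv.smul h2

open scoped MatrixOrder in
theorem sqrt_of_not_posSemidef {n : ℕ} {S : Matrix (Fin n) (Fin n) ℝ} (hS : ¬ S.PosSemidef) :
    CFC.sqrt S = 0 := by
  rw [CFC.sqrt, cfcₙ_apply_of_not_predicate]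
  change ¬ (S - 0).PosSemidef
  simpa

theorem measurableSet_posSemidef (n : ℕ) :
    MeasurableSet {S : Matrix (Fin n) (Fin n) ℝ | S.PosSemidef} := by
  have h : {S : Matrix (Fin n) (Fin n) ℝ | S.PosSemidef} =
      {S | Sᴴ = S} ∩ ⋂ x : Fin n → ℝ, {S | 0 ≤ star x ⬝ᵥ (S *ᵥ x)} := by
    ext S
    simp [Matrix.posSemidef_iff_dotProduct_mulVec, Matrix.IsHermitian]
  rw [h]
  refine IsClosed.measurableSet (IsClosed.inter ?_ (isClosed_iInter fun x => ?_))
  · exact isClosed_eq (Continuous.matrix_conjTranspose continuous_id) continuous_id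
  · exact isClosed_le continuous_const
      (Continuous.dotProduct continuous_const (Continuous.matrix_mulVec continuous_id continuous_const))

open scoped MatrixOrder in
/-- Squaring is a continuous injection on positive semidefinite matrices, so by the
Lusin–Souslin theorem its inverse is Borel measurable. -/
theorem measurable_sqrt_matrix (n : ℕ) :
    Measurable fun S : Matrix (Fin n) (Fin n) ℝ => CFC.sqrt S := by
  have : PolishSpace (Matrix (Fin n) (Fin n) ℝ) :=
    inferInstanceAs (PolishSpace (Fin n → Fin n → ℝ))
  intro t ht
  let P : Set (Matrix (Fin n) (Fin n) ℝ) := {S | S.PosSemidef}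
  have hP : MeasurableSet P := measurableSet_posSemidef n
  have himg : MeasurableSet ((fun A : Matrix (Fin n) (Fin n) ℝ => A * A) '' (t ∩ P)) := by
    refine (ht.inter hP).image_of_continuousOn_injOn ?_ ?_
    · exact (Continuous.matrix_mul continuous_id continuous_id).continuousOn
    · rintro A ⟨-, hA⟩ B ⟨-, hB⟩ hAB
      have hA' : 0 ≤ A := Matrix.PosSemidef.nonneg hA
      have hB' : 0 ≤ B := Matrix.PosSemidef.nonneg hB
      have h1 : CFC.sqrt (A * A) = A := CFC.sqrt_mul_self A hA'
      have h2 : CFC.sqrt (B * B) = B := CFC.sqrt_mul_self B hB'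
      rw [← h1, ← h2]
      exact congrArg CFC.sqrt hAB
  have hset : (fun S : Matrix (Fin n) (Fin n) ℝ => CFC.sqrt S) ⁻¹' t =
      ((fun A : Matrix (Fin n) (Fin n) ℝ => A * A) '' (t ∩ P)) ∪
        (Pᶜ ∩ {_S | (0 : Matrix (Fin n) (Fin n) ℝ) ∈ t}) := by
    ext S
    by_cases hS : S.PosSemidef
    · have hS0 : 0 ≤ S := Matrix.PosSemidef.nonneg hS
      constructor
      · intro h
        exact Or.inl ⟨CFC.sqrt S, ⟨h, Matrix.nonneg_iff_posSemidef.mp (CFC.sqrt_nonneg S)⟩,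
          CFC.sqrt_mul_sqrt_self S hS0⟩
      · rintro (⟨A, ⟨hAt, hA⟩, rfl⟩ | ⟨h, -⟩)
        · change CFC.sqrt (A * A) ∈ t
          rwa [CFC.sqrt_mul_self A (Matrix.PosSemidef.nonneg hA)]
        · exact absurd hS h
    · constructor
      · intro h
        refine Or.inr ⟨hS, ?_⟩
        change CFC.sqrt S ∈ t at h
        rwa [sqrt_of_not_posSemidef hS] at h
      · rintro (⟨A, ⟨-, hA⟩, rfl⟩ | ⟨-, h⟩)
        · refine absurd ?_ hS
          have : A * A = A * Aᴴ := by rw [hA.isHermitian.eq]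
          change (A * A).PosSemidef
          rw [this]
          exact Matrix.posSemidef_self_mul_conjTranspose A
        · change CFC.sqrt S ∈ t
          rwa [sqrt_of_not_posSemidef hS]
  rw [hset]
  exact himg.union (hP.compl.inter (MeasurableSet.const _))

theorem measurable_toLp_mulVec (n : ℕ) :
    Measurable fun p : Matrix (Fin n) (Fin n) ℝ × EuclideanSpace ℝ (Fin n) =>
      (WithLp.toLp 2 (p.1 *ᵥ WithLp.ofLp p.2) : EuclideanSpace ℝ (Fin n)) := by
  have : BorelSpace (Matrix (Fin n) (Fin n) ℝ × EuclideanSpace ℝ (Fin n)) :=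
    inferInstanceAs (BorelSpace ((Fin n → Fin n → ℝ) × EuclideanSpace ℝ (Fin n)))
  exact Continuous.measurable <| (PiLp.continuous_toLp 2 _).comp
    (Continuous.matrix_mulVec continuous_fst
      ((PiLp.continuous_ofLp 2 _).comp continuous_snd))

open scoped MatrixOrder in
theorem multivariateGaussian_zero_eq_map {n : ℕ} (S : Matrix (Fin n) (Fin n) ℝ) :
    multivariateGaussian (0 : EuclideanSpace ℝ (Fin n)) S =
      (stdGaussian (EuclideanSpace ℝ (Fin n))).map
        fun x => WithLp.toLp 2 (CFC.sqrt S *ᵥ WithLp.ofLp x) := by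
  rw [multivariateGaussian]
  congr 1
  funext x
  rw [zero_add]
  rfl

theorem measurable_map_mulVec (n : ℕ) (μ : Measure (EuclideanSpace ℝ (Fin n))) [SFinite μ] :
    Measurable fun A : Matrix (Fin n) (Fin n) ℝ =>
      μ.map fun x => (WithLp.toLp 2 (A *ᵥ WithLp.ofLp x) : EuclideanSpace ℝ (Fin n)) := by
  refine Measure.measurable_of_measurable_coe _ fun s hs => ?_
  have h : ∀ A : Matrix (Fin n) (Fin n) ℝ,
      (μ.map fun x => (WithLp.toLp 2 (A *ᵥ WithLp.ofLp x) : EuclideanSpace ℝ (Fin n))) s =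
        μ (Prod.mk A ⁻¹'
          ((fun p : Matrix (Fin n) (Fin n) ℝ × EuclideanSpace ℝ (Fin n) =>
            (WithLp.toLp 2 (p.1 *ᵥ WithLp.ofLp p.2) : EuclideanSpace ℝ (Fin n))) ⁻¹' s)) :=
    fun A => Measure.map_apply ((measurable_toLp_mulVec n).comp measurable_prodMk_left) hs
  simp_rw [h]
  exact measurable_measure_prodMk_left (measurable_toLp_mulVec n hs)

theorem measurable_multivariateGaussian (n : ℕ) (c : ℝ) :
    Measurable fun S : Matrix (Fin n) (Fin n) ℝ =>
      multivariateGaussian (0 : EuclideanSpace ℝ (Fin n)) (c • S) := by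
  simp_rw [multivariateGaussian_zero_eq_map]
  exact (measurable_map_mulVec n _).comp
    ((measurable_sqrt_matrix n).comp (continuous_const_smul c).measurable)

/-- The conditional law `y | S ∼ N(0, c S)`, as a Markov kernel `S ↦ N(0, c S)`. -/
def gaussianKernel (n : ℕ) (c : ℝ) :
    Kernel (Matrix (Fin n) (Fin n) ℝ) (EuclideanSpace ℝ (Fin n)) where
  toFun S := multivariateGaussian 0 (c • S)
  measurable' := measurable_multivariateGaussian n c

instance isMarkovKernel_gaussianKernel (n : ℕ) (c : ℝ) :
    IsMarkovKernel (gaussianKernel n c) :=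
  ⟨fun S => by
    change IsProbabilityMeasure (multivariateGaussian 0 (c • S))
    infer_instance⟩

/-- The linear-kernel covariance `X Xᵀ + v I`. -/
def linearCov {n q : ℕ} (X : Matrix (Fin n) (Fin q) ℝ) (v : ℝ) : Matrix (Fin n) (Fin n) ℝ :=
  X * Xᵀ + v • (1 : Matrix (Fin n) (Fin n) ℝ)

/-- Joint law of `(S, y)` in the PCA-esque model
`y | S ∼ N(0, S / ρ)`, `S ∼ W(X Xᵀ + σ² I, ρ)`. -/
def pcaModel {n q : ℕ} (X : Matrix (Fin n) (Fin q) ℝ) (σ ρ : ℝ) :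
    Measure (Matrix (Fin n) (Fin n) ℝ × EuclideanSpace ℝ (Fin n)) :=
  wishart (linearCov X (σ ^ 2)) ρ ⊗ₘ gaussianKernel n (1 / ρ)

/-- Joint law of `(S, y)` in the MCA-esque model
`y | S ∼ N(0, (ρ - n + 1) S)`, `S ∼ W⁻¹(X Xᵀ + β I, ρ)`. -/
def mcaModel {n q : ℕ} (X : Matrix (Fin n) (Fin q) ℝ) (β ρ : ℝ) :
    Measure (Matrix (Fin n) (Fin n) ℝ × EuclideanSpace ℝ (Fin n)) :=
  invWishart (linearCov X β) ρ ⊗ₘ gaussianKernel n (ρ - n + 1)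

/-- Weak convergence (convergence in distribution) of the measures `μ ρ` to `ν` as the real
parameter `ρ` tends to infinity; the `μ ρ` are required to be probability laws for large `ρ`. -/
def ConvergesWeakly {E : Type*} [TopologicalSpace E] [MeasurableSpace E]
    (μ : ℝ → Measure E) (ν : Measure E) : Prop :=
  (∀ᶠ ρ in atTop, IsProbabilityMeasure (μ ρ)) ∧
    ∀ f : BoundedContinuousFunction E ℝ,
      Tendsto (fun ρ => ∫ y, f y ∂(μ ρ)) atTop (𝓝 (∫ y, f y ∂ν))

/-- `ν` is the law of the observations `y i = f (x i) + ε i`, where `x i` is the `i`-th row of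
`X`, `f` is a centred Gaussian process on `ℝ^q` with the linear kernel `k(x, x') = ⟪x, x'⟫`, and
the noise `ε ∼ N(0, v I)` is independent of `f`. -/
def IsLinearGPLaw {n q : ℕ} (X : Matrix (Fin n) (Fin q) ℝ) (v : ℝ)
    (ν : Measure (EuclideanSpace ℝ (Fin n))) : Prop :=
  ∃ (Ω : Type) (_ : MeasurableSpace Ω) (P : Measure Ω)
    (f : EuclideanSpace ℝ (Fin q) → Ω → ℝ) (ε : Ω → EuclideanSpace ℝ (Fin n)),
    IsProbabilityMeasure P ∧ IsGaussianProcess f P ∧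
    (∀ x, ∫ ω, f x ω ∂P = 0) ∧
    (∀ x x', covariance (f x) (f x') P = inner ℝ x x') ∧
    HasLaw ε (multivariateGaussian 0 (v • (1 : Matrix (Fin n) (Fin n) ℝ))) P ∧
    IndepFun (fun ω x => f x ω) ε P ∧
    HasLaw (fun ω => WithLp.toLp 2 fun i => f (WithLp.toLp 2 (X i)) ω + ε ω i) ν P

end ProbDR

end

namespace ProbDR

/-! Each marginal is a Gaussian mixture, so its characteristic function at `t` is the average over
the mixing matrix of `exp (-tᵀΣt/2)`, with `Σ` the conditional covariance. This integrand is bounded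
by 1 and continuous in `Σ`. By Lévy's theorem it is enough that `Σ` concentrates at the claimed
covariance.

Concentration is Laplace's method. After `S` is replaced by `ρ • S`, the Wishart density is, up to a
constant, a fixed integrable weight times `φ ^ k`, where `φ S = det (M⁻¹S) exp (n - tr (M⁻¹S))` and
`k = (ρ-n-1)/2` (`wishart_eq_map_powLaw`). A congruence turns `M⁻¹S` into a positive definite `R`,
and `φ` becomes the product of `x e^{1-x}` over the eigenvalues of `R`. Each factor is at most 1 and
is close to 1 only near `x = 1`, so `φ` peaks at `M` alone (`comap_wishartPeak_le`). Normalised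
powers of `φ` therefore concentrate at `M` (`tendsto_integral_powLaw`).

For the inverse-Wishart model the same result is applied with scale `Ψ⁻¹`, followed by continuity of
inversion. The process interpretation takes `f x = ⟪x, w⟫` with `w` standard Gaussian. -/

/-! ### The scalar function `x e^{1-x}` and its maximum at 1. -/

theorem mul_exp_one_sub_lt_one {x : ℝ} (hx : x ≠ 1) : x * Real.exp (1 - x) < 1 := by
  have h := Real.add_one_lt_exp (sub_ne_zero.mpr hx)
  have h2 : Real.exp (x - 1) * Real.exp (1 - x) = 1 := by
    rw [← Real.exp_add]; simp
  nlinarith [Real.exp_pos (1 - x)]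

theorem mul_exp_one_sub_le_one (x : ℝ) : x * Real.exp (1 - x) ≤ 1 := by
  rcases eq_or_ne x 1 with rfl | hx
  · simp
  · exact (mul_exp_one_sub_lt_one hx).le

/-- Monotonicity on either side of the peak, in one statement: the sign condition says that `y` lies
weakly between 1 and `x`. It is exactly what gives `x/y - 1 ≤ x - y`, hence `x/y ≤ e^{x-y}`. -/
theorem mul_exp_one_sub_le {x y : ℝ} (hy : 0 < y) (h : 0 ≤ (x - y) * (y - 1)) :
    x * Real.exp (1 - x) ≤ y * Real.exp (1 - y) := by
  have h1 : x / y ≤ Real.exp (x - y) := by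
    refine (by linarith [Real.add_one_le_exp (x / y - 1)] :
      x / y ≤ Real.exp (x / y - 1)).trans (Real.exp_le_exp.mpr ?_)
    rw [div_sub_one hy.ne', div_le_iff₀ hy]
    linarith
  rw [div_le_iff₀ hy] at h1
  have h2 : Real.exp (1 - y) = Real.exp (x - y) * Real.exp (1 - x) := by
    rw [← Real.exp_add]; ring_nf
  rw [h2]
  nlinarith [Real.exp_pos (1 - x)]

theorem exists_lt_one_abs_sub_one_lt {ε : ℝ} (hε : 0 < ε) :
    ∃ a < 1, ∀ x > 0, a < x * Real.exp (1 - x) → |x - 1| < ε := by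
  refine ⟨max ((1 + ε) * Real.exp (1 - (1 + ε))) ((1 - ε) * Real.exp (1 - (1 - ε))),
    max_lt (mul_exp_one_sub_lt_one (by linarith)) (mul_exp_one_sub_lt_one (by linarith)),
    fun x hx h => ?_⟩
  rw [max_lt_iff] at h
  by_contra! hc
  -- In the left case `0 < x ≤ 1 - ε`, which supplies the positivity of `1 - ε`.
  rcases le_abs'.mp hc with hc | hc
  · exact absurd (mul_exp_one_sub_le (y := 1 - ε) (by linarith) (by nlinarith)) h.2.not_ge
  · exact absurd (mul_exp_one_sub_le (y := 1 + ε) (by linarith) (by nlinarith)) h.1.not_ge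

/-! ### Spectral estimates for positive definite matrices. -/

theorem abs_unitary_conj_diagonal_apply_le {n : ℕ} (U : Matrix.unitaryGroup (Fin n) ℝ)
    (d : Fin n → ℝ) (i j : Fin n) :
    |((U : Matrix (Fin n) (Fin n) ℝ) * diagonal d * (star U : Matrix (Fin n) (Fin n) ℝ)) i j| ≤
      ∑ k, |d k| := by
  rw [Matrix.mul_apply]
  refine (Finset.abs_sum_le_sum_abs _ _).trans (Finset.sum_le_sum fun k _ => ?_)
  have h1 := entry_norm_bound_of_unitary U.2 i k
  have h2 := entry_norm_bound_of_unitary U.2 j k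
  rw [Real.norm_eq_abs] at h1 h2
  rw [Matrix.mul_diagonal, abs_mul, abs_mul, star_apply, star_trivial]
  have h3 : |(U : Matrix (Fin n) (Fin n) ℝ) i k| * |d k| ≤ |d k| :=
    mul_le_of_le_one_left (abs_nonneg _) h1
  exact (mul_le_of_le_one_right (by positivity) h2).trans h3

theorem spectral_eq {n : ℕ} {R : Matrix (Fin n) (Fin n) ℝ} (hR : R.IsHermitian) :
    R = (hR.eigenvectorUnitary : Matrix (Fin n) (Fin n) ℝ) * diagonal hR.eigenvalues *
      (star hR.eigenvectorUnitary : Matrix (Fin n) (Fin n) ℝ) := by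
  have h := hR.spectral_theorem
  simpa [Unitary.conjStarAlgAut_apply, Function.comp_def] using h

theorem abs_apply_sub_one_le {n : ℕ} {R : Matrix (Fin n) (Fin n) ℝ} (hR : R.IsHermitian)
    (i j : Fin n) : |(R - 1) i j| ≤ ∑ k, |hR.eigenvalues k - 1| := by
  have h : R - 1 = (hR.eigenvectorUnitary : Matrix (Fin n) (Fin n) ℝ) *
      diagonal (fun k => hR.eigenvalues k - 1) *
      (star hR.eigenvectorUnitary : Matrix (Fin n) (Fin n) ℝ) := by
    have h1 : (1 : Matrix (Fin n) (Fin n) ℝ) = (hR.eigenvectorUnitary : Matrix (Fin n) (Fin n) ℝ) *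
        1 * (star hR.eigenvectorUnitary : Matrix (Fin n) (Fin n) ℝ) := by
      rw [mul_one]
      exact (Unitary.mul_star_self_of_mem hR.eigenvectorUnitary.2).symm
    have h2 : diagonal (fun k => hR.eigenvalues k - 1) = diagonal hR.eigenvalues - 1 := by
      rw [← diagonal_one, diagonal_sub]
    rw [h2, mul_sub, sub_mul, ← h1, ← spectral_eq hR]
  conv_lhs => rw [h]
  exact abs_unitary_conj_diagonal_apply_le _ _ i j

theorem _root_.Matrix.PosSemidef.abs_apply_le_trace {n : ℕ} {R : Matrix (Fin n) (Fin n) ℝ} (hR : R.PosSemidef)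
    (i j : Fin n) : |R i j| ≤ R.trace := by
  have h : R.trace = ∑ k, |hR.1.eigenvalues k| := by
    rw [hR.1.trace_eq_sum_eigenvalues]
    exact Finset.sum_congr rfl fun k _ => (abs_of_nonneg (hR.eigenvalues_nonneg k)).symm
  rw [h]
  conv_lhs => rw [spectral_eq hR.1]
  exact abs_unitary_conj_diagonal_apply_le _ _ i j

/-- Determinant and trace are the product and sum of the eigenvalues; this reduces the matrix peak
to the scalar one. -/
theorem _root_.Matrix.PosDef.det_mul_exp_trace_eq {n : ℕ} {R : Matrix (Fin n) (Fin n) ℝ} (hR : R.PosDef) :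
    R.det * Real.exp (n - R.trace) =
      ∏ i, hR.1.eigenvalues i * Real.exp (1 - hR.1.eigenvalues i) := by
  rw [hR.1.det_eq_prod_eigenvalues, hR.1.trace_eq_sum_eigenvalues, Finset.prod_mul_distrib,
    ← Real.exp_sum, Finset.sum_sub_distrib]
  simp

theorem _root_.Matrix.PosDef.det_mul_exp_trace_le_one {n : ℕ} {R : Matrix (Fin n) (Fin n) ℝ} (hR : R.PosDef) :
    R.det * Real.exp (n - R.trace) ≤ 1 := by
  rw [hR.det_mul_exp_trace_eq]
  exact Finset.prod_le_one
    (fun i _ => mul_nonneg (hR.eigenvalues_pos i).le (Real.exp_pos _).le)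
    (fun i _ => mul_exp_one_sub_le_one _)

/-- All factors are at most 1, so a product above `a` forces each factor above `a`. Every eigenvalue
is then near 1, and the eigenvalue deviations bound the entries of `R - 1`. -/
theorem exists_lt_one_abs_apply_sub_one_lt (n : ℕ) {ε : ℝ} (hε : 0 < ε) :
    ∃ a < 1, ∀ R : Matrix (Fin n) (Fin n) ℝ, R.PosDef → a < R.det * Real.exp (n - R.trace) →
      ∀ i j, |(R - 1) i j| < ε := by
  -- Dividing by `n + 1` instead of `n` covers `n = 0` and makes the final bound strict.
  have hn : (0 : ℝ) < n + 1 := by positivity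
  obtain ⟨a, ha, h⟩ := exists_lt_one_abs_sub_one_lt (div_pos hε hn)
  refine ⟨a, ha, fun R hR hRa i j => (abs_apply_sub_one_le hR.1 i j).trans_lt ?_⟩
  rw [hR.det_mul_exp_trace_eq] at hRa
  have hk : ∀ k, |hR.1.eigenvalues k - 1| ≤ ε / (n + 1) := fun k => by
    refine (h _ (hR.eigenvalues_pos k) (hRa.trans_le ?_)).le
    rw [← Finset.mul_prod_erase _ _ (Finset.mem_univ k)]
    refine mul_le_of_le_one_right (mul_nonneg (hR.eigenvalues_pos k).le (Real.exp_pos _).le) ?_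
    exact Finset.prod_le_one
      (fun i _ => mul_nonneg (hR.eigenvalues_pos i).le (Real.exp_pos _).le)
      (fun i _ => mul_exp_one_sub_le_one _)
  calc ∑ k, |hR.1.eigenvalues k - 1| ≤ ∑ _k : Fin n, ε / (n + 1) :=
        Finset.sum_le_sum fun k _ => hk k
    _ = n * (ε / (n + 1)) := by simp
    _ < (n + 1) * (ε / (n + 1)) := by
        have := div_pos hε hn
        nlinarith
    _ = ε := by field_simp

/-! ### The peak function of the Wishart density. -/

open scoped MatrixOrder in
theorem _root_.Matrix.PosDef.exists_inv_eq_transpose_mul_self {n : ℕ} {M : Matrix (Fin n) (Fin n) ℝ}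
    (hM : M.PosDef) : ∃ A : Matrix (Fin n) (Fin n) ℝ, IsUnit A ∧ M⁻¹ = Aᵀ * A := by
  obtain ⟨A, hA⟩ := CStarAlgebra.nonneg_iff_eq_star_mul_self.mp hM.inv.posSemidef.nonneg
  rw [star_eq_conjTranspose, conjTranspose_eq_transpose_of_trivial] at hA
  refine ⟨A, (isUnit_iff_isUnit_det A).mpr (isUnit_iff_ne_zero.mpr fun h => ?_), hA⟩
  have := hM.inv.det_pos
  rw [hA, det_mul, h, mul_zero] at this
  exact lt_irrefl _ this

/-- The function `|M⁻¹ S| exp(n - tr(M⁻¹ S))` on positive definite matrices, extended by zero. -/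
noncomputable def wishartPeak {n : ℕ} (M : Matrix (Fin n) (Fin n) ℝ) :
    Matrix (Fin n) (Fin n) ℝ → ℝ :=
  Set.indicator {S | S.PosDef} fun S => (M⁻¹ * S).det * Real.exp (n - (M⁻¹ * S).trace)

theorem wishartPeak_of_posDef {n : ℕ} (M : Matrix (Fin n) (Fin n) ℝ)
    {S : Matrix (Fin n) (Fin n) ℝ} (hS : S.PosDef) :
    wishartPeak M S = (M⁻¹ * S).det * Real.exp (n - (M⁻¹ * S).trace) :=
  Set.indicator_of_mem (s := {S : Matrix (Fin n) (Fin n) ℝ | S.PosDef}) hS _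

theorem wishartPeak_of_not_posDef {n : ℕ} (M : Matrix (Fin n) (Fin n) ℝ)
    {S : Matrix (Fin n) (Fin n) ℝ} (hS : ¬ S.PosDef) : wishartPeak M S = 0 :=
  Set.indicator_of_notMem (s := {S : Matrix (Fin n) (Fin n) ℝ | S.PosDef}) hS _

/-- `M⁻¹S` need not be symmetric. Commuting factors inside determinant and trace replaces it by the
congruent matrix `A S Aᵀ`, to which the spectral estimates apply. -/
theorem wishartPeak_eq_conj {n : ℕ} {M A S : Matrix (Fin n) (Fin n) ℝ} (hA : M⁻¹ = Aᵀ * A)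
    (hS : S.PosDef) :
    wishartPeak M S = (A * S * Aᵀ).det * Real.exp (n - (A * S * Aᵀ).trace) := by
  rw [wishartPeak_of_posDef M hS, hA, mul_assoc, det_mul_comm, trace_mul_comm]

theorem _root_.Matrix.PosDef.conj {n : ℕ} {A S : Matrix (Fin n) (Fin n) ℝ} (hA : IsUnit A) (hS : S.PosDef) :
    (A * S * Aᵀ).PosDef := by
  have h := hA.posDef_star_right_conjugate_iff.mpr hS
  rwa [star_eq_conjTranspose, conjTranspose_eq_transpose_of_trivial] at h

theorem wishartPeak_nonneg {n : ℕ} {M : Matrix (Fin n) (Fin n) ℝ} (hM : M.PosDef)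
    (S : Matrix (Fin n) (Fin n) ℝ) : 0 ≤ wishartPeak M S := by
  by_cases hS : S.PosDef
  · rw [wishartPeak_of_posDef M hS, det_mul]
    exact mul_nonneg (mul_pos hM.inv.det_pos hS.det_pos).le (Real.exp_pos _).le
  · rw [wishartPeak_of_not_posDef M hS]

theorem wishartPeak_le_one {n : ℕ} {M : Matrix (Fin n) (Fin n) ℝ} (hM : M.PosDef)
    (S : Matrix (Fin n) (Fin n) ℝ) : wishartPeak M S ≤ 1 := by
  obtain ⟨A, hA, hMA⟩ := hM.exists_inv_eq_transpose_mul_self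
  by_cases hS : S.PosDef
  · rw [wishartPeak_eq_conj hMA hS]
    exact (hS.conj hA).det_mul_exp_trace_le_one
  · rw [wishartPeak_of_not_posDef M hS]
    exact zero_le_one

theorem eventually_posDef_comap_wishartPeak {n : ℕ} (M : Matrix (Fin n) (Fin n) ℝ) :
    ∀ᶠ S in comap (wishartPeak M) (𝓝 1), S.PosDef := by
  filter_upwards [preimage_mem_comap (lt_mem_nhds (zero_lt_one' ℝ))] with S hS
  by_contra h
  rw [Set.mem_preimage, wishartPeak_of_not_posDef M h] at hS
  exact lt_irrefl (0 : ℝ) hS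

theorem eq_inv_mul_conj_mul_inv {n : ℕ} {A : Matrix (Fin n) (Fin n) ℝ} (hA : IsUnit A)
    (S : Matrix (Fin n) (Fin n) ℝ) : S = A⁻¹ * (A * S * Aᵀ) * A⁻¹ᵀ := by
  have hd : IsUnit A.det := (isUnit_iff_isUnit_det A).mp hA
  have h : Aᵀ * A⁻¹ᵀ = 1 := by rw [← transpose_mul, nonsing_inv_mul _ hd, transpose_one]
  rw [mul_assoc, mul_assoc (A * S), h, mul_one, nonsing_inv_mul_cancel_left _ _ hd]

/-- `wishartPeak M` is close to its maximal value `1` only near `M`. -/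
theorem comap_wishartPeak_le {n : ℕ} {M : Matrix (Fin n) (Fin n) ℝ} (hM : M.PosDef) :
    comap (wishartPeak M) (𝓝 1) ≤ 𝓝 M := by
  obtain ⟨A, hA, hMA⟩ := hM.exists_inv_eq_transpose_mul_self
  have hd : IsUnit A.det := (isUnit_iff_isUnit_det A).mp hA
  have hM' : M = A⁻¹ * 1 * A⁻¹ᵀ := by
    have hMd : IsUnit M.det := (isUnit_iff_isUnit_det M).mp hM.isUnit
    rw [mul_one, transpose_nonsing_inv, ← Matrix.mul_inv_rev, ← hMA, nonsing_inv_nonsing_inv _ hMd]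
  -- In the coordinate `A S Aᵀ` the peak sits at the identity; the inverse congruence then carries
  -- the convergence back to `M`.
  have hR : Tendsto (fun S => A * S * Aᵀ) (comap (wishartPeak M) (𝓝 1)) (𝓝 1) := by
    refine tendsto_pi_nhds.mpr fun i => tendsto_pi_nhds.mpr fun j => ?_
    rw [Metric.tendsto_nhds]
    intro ε hε
    obtain ⟨a, ha, h⟩ := exists_lt_one_abs_apply_sub_one_lt n hε
    filter_upwards [preimage_mem_comap (lt_mem_nhds ha), eventually_posDef_comap_wishartPeak M]
      with S hS hSp
    rw [Set.mem_preimage, wishartPeak_eq_conj hMA hSp] at hS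
    simpa [Real.dist_eq] using h _ (hSp.conj hA) hS i j
  have hc : Continuous fun R : Matrix (Fin n) (Fin n) ℝ => A⁻¹ * R * A⁻¹ᵀ :=
    (continuous_const.matrix_mul continuous_id).matrix_mul continuous_const
  have := (hc.tendsto 1).comp hR
  rw [← hM'] at this
  refine (tendsto_id'.mp (this.congr fun S => ?_))
  exact (eq_inv_mul_conj_mul_inv hA S).symm

/-- Coercivity of the trace, needed for integrability of the weight. The entries of `R = A S Aᵀ` are
at most `tr R = tr (M⁻¹S)`, and `S` is a fixed linear image of `R`. -/
theorem exists_mul_sum_abs_le_trace {n : ℕ} {M : Matrix (Fin n) (Fin n) ℝ} (hM : M.PosDef) :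
    ∃ c > 0, ∀ S : Matrix (Fin n) (Fin n) ℝ, S.PosDef →
      c * ∑ i, ∑ j, |S i j| ≤ (M⁻¹ * S).trace := by
  obtain ⟨A, hA, hMA⟩ := hM.exists_inv_eq_transpose_mul_self
  set B := A⁻¹
  set C : ℝ := ∑ i, ∑ j, ∑ l, ∑ k, |B i k| * |B j l|
  have hC : 0 ≤ C := Finset.sum_nonneg fun _ _ => Finset.sum_nonneg fun _ _ =>
    Finset.sum_nonneg fun _ _ => Finset.sum_nonneg fun _ _ =>
      mul_nonneg (abs_nonneg _) (abs_nonneg _)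
  have hC1 : 0 < C + 1 := by linarith
  -- Adding 1 avoids inverting `C = 0`, as happens for `n = 0`.
  refine ⟨(C + 1)⁻¹, inv_pos.mpr hC1, fun S hS => ?_⟩
  have hR := hS.conj hA
  set R := A * S * Aᵀ with hRdef
  have htr : (M⁻¹ * S).trace = R.trace := by
    rw [hMA, mul_assoc, trace_mul_comm]
  have hpos : 0 ≤ R.trace := hR.posSemidef.trace_nonneg
  rw [htr, inv_mul_le_iff₀ hC1]
  have : ∑ i, ∑ j, |S i j| ≤ C * R.trace := by
    simp only [C, Finset.sum_mul]
    refine Finset.sum_le_sum fun i _ => Finset.sum_le_sum fun j _ => ?_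
    rw [eq_inv_mul_conj_mul_inv hA S, Matrix.mul_apply]
    refine (Finset.abs_sum_le_sum_abs _ _).trans (Finset.sum_le_sum fun l _ => ?_)
    rw [Matrix.mul_apply, Finset.sum_mul]
    refine (Finset.abs_sum_le_sum_abs _ _).trans (Finset.sum_le_sum fun k _ => ?_)
    rw [abs_mul, abs_mul, transpose_apply, mul_right_comm]
    exact mul_le_mul_of_nonneg_left (hR.posSemidef.abs_apply_le_trace k l)
      (mul_nonneg (abs_nonneg _) (abs_nonneg _))
  linarith

/-- The quadratic form is positive on the compact unit sphere, hence stays positive there for nearby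
matrices; homogeneity extends this to all nonzero vectors. -/
theorem _root_.Matrix.PosDef.eventually_posDef {n : ℕ} {M : Matrix (Fin n) (Fin n) ℝ} (hM : M.PosDef) :
    ∀ᶠ S in 𝓝 M, S.IsHermitian → S.PosDef := by
  have h : ∀ᶠ S in 𝓝 M, ∀ x ∈ Metric.sphere (0 : Fin n → ℝ) 1, 0 < x ⬝ᵥ (S *ᵥ x) := by
    refine (isCompact_sphere _ _).eventually_forall_of_forall_eventually fun x hx => ?_
    have hc : Continuous fun p : Matrix (Fin n) (Fin n) ℝ × (Fin n → ℝ) =>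
        p.2 ⬝ᵥ (p.1 *ᵥ p.2) :=
      continuous_snd.dotProduct (continuous_fst.matrix_mulVec continuous_snd)
    have hx0 : x ≠ 0 := by
      rintro rfl
      simp at hx
    refine hc.continuousAt.eventually (lt_mem_nhds ?_)
    simpa using hM.dotProduct_mulVec_pos hx0
  filter_upwards [h] with S hS hH
  refine posDef_iff_dotProduct_mulVec.mpr ⟨hH, fun x hx => ?_⟩
  have hx' : 0 < ‖x‖ := norm_pos_iff.mpr hx
  have := hS (‖x‖⁻¹ • x) (by simp [norm_smul, hx'.ne'])
  rw [mulVec_smul, dotProduct_smul, smul_dotProduct, smul_eq_mul, smul_eq_mul, ← mul_assoc] at this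
  exact (mul_pos_iff_of_pos_left (by positivity)).mp this

theorem measurableSet_posDef (n : ℕ) :
    MeasurableSet {S : Matrix (Fin n) (Fin n) ℝ | S.PosDef} := by
  have h : {S : Matrix (Fin n) (Fin n) ℝ | S.PosDef} =
      {S | S.PosSemidef} ∩ {S | S.det ≠ 0} := by
    ext S
    exact ⟨fun h => ⟨h.posSemidef, h.det_pos.ne'⟩,
      fun h => h.1.posDef_iff_det_ne_zero.mpr h.2⟩
  rw [h]
  exact (measurableSet_posSemidef n).inter
    ((Continuous.matrix_det continuous_id).measurable (measurableSet_singleton 0).compl)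

theorem measurable_wishartPeak {n : ℕ} (M : Matrix (Fin n) (Fin n) ℝ) :
    Measurable (wishartPeak M) := by
  refine Measurable.indicator (Continuous.measurable ?_) (measurableSet_posDef n)
  have h : Continuous fun S : Matrix (Fin n) (Fin n) ℝ => M⁻¹ * S :=
    continuous_const.matrix_mul continuous_id
  exact h.matrix_det.mul (Real.continuous_exp.comp (continuous_const.sub h.matrix_trace))

/-- The measure `φ ^ k • ν`. -/
noncomputable def powDensity {α : Type*} [MeasurableSpace α] (ν : Measure α) (φ : α → ℝ) (k : ℝ) :
    Measure α :=
  ν.withDensity fun x => ENNReal.ofReal (φ x ^ k)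

/-- The probability measure proportional to `φ ^ k • ν`. -/
noncomputable def powLaw {α : Type*} [MeasurableSpace α] (ν : Measure α) (φ : α → ℝ) (k : ℝ) :
    Measure α :=
  (powDensity ν φ k Set.univ)⁻¹ • powDensity ν φ k

/-! ### Laplace's method for powers of a function with supremum 1. -/

section PeakConcentration

variable {α : Type*} [MeasurableSpace α] {ν : Measure α} {φ : α → ℝ}

theorem powDensity_le (hφ0 : ∀ x, 0 ≤ φ x) {a k : ℝ} (hk : 0 ≤ k) {s : Set α}
    (hs : MeasurableSet s) (h : ∀ x ∈ s, φ x ≤ a) :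
    powDensity ν φ k s ≤ ENNReal.ofReal (a ^ k) * ν s := by
  rw [powDensity, withDensity_apply _ hs, ← setLIntegral_const]
  exact setLIntegral_mono measurable_const fun x hx =>
    ENNReal.ofReal_le_ofReal (Real.rpow_le_rpow (hφ0 x) (h x hx) hk)

theorem le_powDensity {b k : ℝ} (hb : 0 ≤ b) (hk : 0 ≤ k) {s : Set α}
    (hφ : Measurable φ) (hs : MeasurableSet s) (h : ∀ x ∈ s, b ≤ φ x) :
    ENNReal.ofReal (b ^ k) * ν s ≤ powDensity ν φ k s := by
  rw [powDensity, withDensity_apply _ hs, ← setLIntegral_const]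
  exact setLIntegral_mono (hφ.pow_const k).ennreal_ofReal fun x hx =>
    ENNReal.ofReal_le_ofReal (Real.rpow_le_rpow hb (h x hx) hk)

theorem powDensity_univ_ne_zero (hφ : Measurable φ) (hpos : ∀ a < 1, ν {x | a < φ x} ≠ 0)
    {k : ℝ} (hk : 0 ≤ k) : powDensity ν φ k Set.univ ≠ 0 := by
  have h := le_powDensity (ν := ν) (b := 1 / 2) (by norm_num) hk hφ
    (measurableSet_lt measurable_const hφ) fun x (hx : 1 / 2 < φ x) => hx.le
  refine ((ENNReal.mul_pos ?_ (hpos _ (by norm_num))).trans_le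
    (h.trans (measure_mono (Set.subset_univ _)))).ne'
  exact (ENNReal.ofReal_pos.mpr (Real.rpow_pos_of_pos (by norm_num) k)).ne'

variable [IsFiniteMeasure ν]

theorem powDensity_univ_ne_top (hφ0 : ∀ x, 0 ≤ φ x) (hφ1 : ∀ x, φ x ≤ 1) {k : ℝ} (hk : 0 ≤ k) :
    powDensity ν φ k Set.univ ≠ ∞ :=
  ((powDensity_le hφ0 hk MeasurableSet.univ fun x _ => hφ1 x).trans_lt
    (ENNReal.mul_lt_top ENNReal.ofReal_lt_top (measure_lt_top ν _))).ne

theorem isProbabilityMeasure_powLaw (hφ : Measurable φ) (hφ0 : ∀ x, 0 ≤ φ x)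
    (hφ1 : ∀ x, φ x ≤ 1) (hpos : ∀ a < 1, ν {x | a < φ x} ≠ 0) {k : ℝ} (hk : 0 ≤ k) :
    IsProbabilityMeasure (powLaw ν φ k) :=
  ⟨by
    rw [powLaw, Measure.smul_apply, smul_eq_mul]
    exact ENNReal.inv_mul_cancel (powDensity_univ_ne_zero hφ hpos hk)
      (powDensity_univ_ne_top hφ0 hφ1 hk)⟩

/-- For `a < b < 1` the unnormalised mass of `{φ ≤ a}` is at most a constant times `a ^ k`, while
the total mass is at least a positive constant times `b ^ k`; the ratio decays geometrically. -/
theorem tendsto_powLaw_le (hφ : Measurable φ) (hφ0 : ∀ x, 0 ≤ φ x)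
    (hpos : ∀ a < 1, ν {x | a < φ x} ≠ 0) {a : ℝ} (ha : a < 1) :
    Tendsto (fun k => powLaw ν φ k {x | φ x ≤ a}) atTop (𝓝 0) := by
  -- `a` may be negative, and the bounds on real powers need a nonnegative base.
  set a' := max a 0
  have ha0 : 0 ≤ a' := le_max_right _ _
  obtain ⟨b, hab, hb1⟩ := exists_between (max_lt ha zero_lt_one : a' < 1)
  have hb : 0 < b := ha0.trans_lt hab
  have hB : ν {x | b < φ x} ≠ 0 := hpos b hb1
  have hBt : ν {x | b < φ x} ≠ ∞ := measure_ne_top _ _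
  have hlim : Tendsto (fun k : ℝ => ENNReal.ofReal ((a' / b) ^ k) *
      (ν Set.univ / ν {x | b < φ x})) atTop (𝓝 0) := by
    have h0 : Tendsto (fun k : ℝ => (a' / b) ^ k) atTop (𝓝 0) :=
      tendsto_rpow_atTop_of_base_lt_one _ (by linarith [div_nonneg ha0 hb.le])
        ((div_lt_one hb).mpr hab)
    have := ENNReal.Tendsto.mul_const (b := ν Set.univ / ν {x | b < φ x})
      (ENNReal.tendsto_ofReal h0) (Or.inr (ENNReal.div_ne_top (measure_ne_top _ _) hB))
    simpa using this
  refine tendsto_of_tendsto_of_tendsto_of_le_of_le' tendsto_const_nhds hlim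
    (Eventually.of_forall fun _ => zero_le) ?_
  filter_upwards [eventually_ge_atTop 0] with k hk
  have h1 : powDensity ν φ k {x | φ x ≤ a} ≤ ENNReal.ofReal (a' ^ k) * ν Set.univ :=
    (powDensity_le hφ0 hk (measurableSet_le hφ measurable_const)
      fun x (hx : φ x ≤ a) => hx.trans (le_max_left _ _)).trans
      (mul_le_mul_right (measure_mono (Set.subset_univ _)) _)
  have h2 : ENNReal.ofReal (b ^ k) * ν {x | b < φ x} ≤ powDensity ν φ k Set.univ :=
    (le_powDensity hb.le hk hφ (measurableSet_lt measurable_const hφ)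
      fun x (hx : b < φ x) => hx.le).trans (measure_mono (Set.subset_univ _))
  have hbk : 0 < b ^ k := Real.rpow_pos_of_pos hb k
  rw [powLaw, Measure.smul_apply, smul_eq_mul, mul_comm, ← div_eq_mul_inv]
  refine (ENNReal.div_le_div h1 h2).trans_eq ?_
  rw [Real.div_rpow ha0 hb.le, ENNReal.ofReal_div_of_pos hbk,
    ENNReal.mul_div_mul_comm (Or.inr hBt) (Or.inr hB)]

/-- Laplace's principle: the normalised measures `φ ^ k • ν` concentrate, as `k → ∞`, where `φ` is
close to its supremum `1`. -/
theorem tendsto_integral_powLaw {E : Type*} [NormedAddCommGroup E] [NormedSpace ℝ E]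
    [CompleteSpace E] (hφ : Measurable φ)
    (hφ0 : ∀ x, 0 ≤ φ x) (hφ1 : ∀ x, φ x ≤ 1) (hpos : ∀ a < 1, ν {x | a < φ x} ≠ 0)
    {G : ℝ → α → E} {L : E} (hGm : ∀ k, StronglyMeasurable (G k)) {C : ℝ}
    (hG : ∀ k x, ‖G k x‖ ≤ C)
    (hL : Tendsto (fun p : ℝ × α => G p.1 p.2) (atTop ×ˢ comap φ (𝓝 1)) (𝓝 L)) :
    Tendsto (fun k => ∫ x, G k x ∂(powLaw ν φ k)) atTop (𝓝 L) := by
  rw [Metric.tendsto_nhds]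
  intro ε hε
  -- The product filter makes the closeness uniform: it holds for all large `k` and all `x` with `φ
  -- x > a` simultaneously. On the remaining set, of vanishing mass, the crude bound `D` is enough.
  have hev := hL.eventually (Metric.ball_mem_nhds L (half_pos hε))
  obtain ⟨K, hK, V, hV, hKV⟩ := mem_prod_iff.mp hev
  obtain ⟨W, hW, hWV⟩ := mem_comap.mp hV
  obtain ⟨a, ha, haW⟩ := exists_Ioc_subset_of_mem_nhds hW (exists_lt 1)
  set D := C + ‖L‖ + 1
  have hsmall : ∀ᶠ k in atTop, (powLaw ν φ k).real {x | φ x ≤ a} * D < ε / 2 := by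
    have h1 := (ENNReal.tendsto_toReal ENNReal.zero_ne_top).comp (tendsto_powLaw_le hφ hφ0 hpos ha)
    have h2 := h1.mul_const D
    simp only [ENNReal.toReal_zero, zero_mul] at h2
    exact h2.eventually (gt_mem_nhds (half_pos hε))
  filter_upwards [hsmall, hK, eventually_ge_atTop 0] with k hk hkK hk0
  have hP := isProbabilityMeasure_powLaw hφ hφ0 hφ1 hpos hk0
  have hs : MeasurableSet {x | φ x ≤ a} := measurableSet_le hφ measurable_const
  have hint : Integrable (G k) (powLaw ν φ k) :=
    .of_bound (hGm k).aestronglyMeasurable C (.of_forall (hG k))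
  have hbound : ∀ x, ‖G k x - L‖ ≤ ε / 2 + {x | φ x ≤ a}.indicator (fun _ => D) x := fun x => by
    by_cases hx : φ x ≤ a
    · rw [Set.indicator_of_mem (s := {x | φ x ≤ a}) hx]
      have := norm_sub_le (G k x) L
      linarith [hG k x]
    · rw [Set.indicator_of_notMem (s := {x | φ x ≤ a}) hx, add_zero, ← dist_eq_norm]
      have : (k, x) ∈ K ×ˢ V := ⟨hkK, hWV (haW ⟨not_le.mp hx, hφ1 x⟩)⟩
      exact (hKV this).le
  have hI : Integrable (fun x => ε / 2 + {x | φ x ≤ a}.indicator (fun _ => D) x)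
      (powLaw ν φ k) := (integrable_const _).add ((integrable_const _).indicator hs)
  calc dist (∫ x, G k x ∂(powLaw ν φ k)) L = ‖∫ x, (G k x - L) ∂(powLaw ν φ k)‖ := by
        rw [integral_sub hint (integrable_const _), dist_eq_norm]; simp
    _ ≤ ∫ x, (ε / 2 + {x | φ x ≤ a}.indicator (fun _ => D) x) ∂(powLaw ν φ k) :=
        norm_integral_le_of_norm_le hI (.of_forall hbound)
    _ = ε / 2 + (powLaw ν φ k).real {x | φ x ≤ a} * D := by
        rw [integral_add (integrable_const _) ((integrable_const _).indicator hs),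
          integral_indicator_const _ hs]
        simp
    _ < ε := by linarith

end PeakConcentration

/-! ### The Wishart law as a rescaled power law. -/

section SymmVolume

variable {n : ℕ}

theorem continuous_symmOfUpper (n : ℕ) : Continuous (symmOfUpper n) := by
  refine continuous_matrix fun i j => ?_
  by_cases h : i ≤ j
  · simpa [symmOfUpper, h] using continuous_apply _
  · simpa [symmOfUpper, h] using continuous_apply _

theorem measurable_symmOfUpper (n : ℕ) : Measurable (symmOfUpper n) :=
  (continuous_symmOfUpper n).measurable

theorem symmOfUpper_smul (r : ℝ) (u : {p : Fin n × Fin n // p.1 ≤ p.2} → ℝ) :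
    symmOfUpper n (r • u) = r • symmOfUpper n u := by
  ext i j
  by_cases h : i ≤ j <;> simp [symmOfUpper, h]

theorem isHermitian_symmOfUpper (u : {p : Fin n × Fin n // p.1 ≤ p.2} → ℝ) :
    (symmOfUpper n u).IsHermitian := by
  ext i j
  rcases lt_trichotomy i j with h | rfl | h
  · simp [symmOfUpper, h.le, h.not_ge]
  · simp
  · simp [symmOfUpper, h.le, h.not_ge]

theorem symmOfUpper_apply (u : {p : Fin n × Fin n // p.1 ≤ p.2} → ℝ)
    (p : {p : Fin n × Fin n // p.1 ≤ p.2}) : symmOfUpper n u p.1.1 p.1.2 = u p := by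
  simp [symmOfUpper, p.2]

theorem symmOfUpper_upper {M : Matrix (Fin n) (Fin n) ℝ} (hM : M.IsHermitian) :
    symmOfUpper n (fun p => M p.1.1 p.1.2) = M := by
  ext i j
  by_cases h : i ≤ j
  · simp [symmOfUpper, h]
  · simpa [symmOfUpper, h] using hM.apply i j

/-- Scaling commutes with the linear parametrisation by upper entries, so this is the scaling rule
of Lebesgue measure. The value of `c` is irrelevant because the Wishart law is normalised. -/
theorem symmVolume_map_smul {r : ℝ} (hr : 0 < r) :
    ∃ c : ℝ≥0∞, c ≠ 0 ∧ c ≠ ∞ ∧ symmVolume n = c • (symmVolume n).map (r • ·) := by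
  have hm : Measurable fun S : Matrix (Fin n) (Fin n) ℝ => r • S :=
    (continuous_const_smul r).measurable
  have h : (symmVolume n).map (r • ·) = ENNReal.ofReal
      |(r ^ Module.finrank ℝ ({p : Fin n × Fin n // p.1 ≤ p.2} → ℝ))⁻¹| • symmVolume n := by
    rw [symmVolume, Measure.map_map hm (measurable_symmOfUpper n), ← Measure.map_smul,
      ← Measure.map_addHaar_smul volume hr.ne', Measure.map_map (measurable_symmOfUpper n)
        (measurable_const_smul r)]
    congr 1
    ext u : 1
    exact (symmOfUpper_smul r u).symm
  set d := ENNReal.ofReal |(r ^ Module.finrank ℝ ({p : Fin n × Fin n // p.1 ≤ p.2} → ℝ))⁻¹|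
  have hd0 : d ≠ 0 := (ENNReal.ofReal_pos.mpr (by positivity)).ne'
  have hdt : d ≠ ∞ := ENNReal.ofReal_ne_top
  refine ⟨d⁻¹, ENNReal.inv_ne_zero.mpr hdt, ENNReal.inv_ne_top.mpr hd0, ?_⟩
  rw [h, smul_smul, ENNReal.inv_mul_cancel hd0 hdt, one_smul]

/-- The integrable factor of the Wishart densities that does not depend on the degrees of
freedom. -/
noncomputable def wishartWeight (M : Matrix (Fin n) (Fin n) ℝ) :
    Matrix (Fin n) (Fin n) ℝ → ℝ≥0∞ :=
  Set.indicator {S | S.PosDef} fun S =>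
    ENNReal.ofReal (Real.exp (-((n + 1) / 2 * (M⁻¹ * S).trace)))

/-- The finite measure on positive definite matrices with density `wishartWeight M`. -/
noncomputable def wishartBase (M : Matrix (Fin n) (Fin n) ℝ) : Measure (Matrix (Fin n) (Fin n) ℝ) :=
  (symmVolume n).withDensity (wishartWeight M)

theorem continuous_inv_mul_trace (M : Matrix (Fin n) (Fin n) ℝ) :
    Continuous fun S : Matrix (Fin n) (Fin n) ℝ => (M⁻¹ * S).trace :=
  (continuous_const.matrix_mul continuous_id).matrix_trace

theorem measurable_wishartWeight (M : Matrix (Fin n) (Fin n) ℝ) :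
    Measurable (wishartWeight M) := by
  refine Measurable.indicator ?_ (measurableSet_posDef n)
  exact ((continuous_inv_mul_trace M).measurable.const_mul _).neg.exp.ennreal_ofReal

theorem integrable_exp_neg_mul_abs {c : ℝ} (hc : 0 < c) :
    Integrable fun x : ℝ => Real.exp (-(c * |x|)) := by
  rw [← integrableOn_univ, ← Set.Iic_union_Ioi (a := (0 : ℝ))]
  refine ((integrableOn_exp_mul_Iic hc 0).congr_fun (fun x hx => ?_) measurableSet_Iic).union
    ((exp_neg_integrableOn_Ioi 0 hc).congr_fun (fun x hx => ?_) measurableSet_Ioi)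
  · simp [abs_of_nonpos (Set.mem_Iic.mp hx)]
  · simp [abs_of_pos (Set.mem_Ioi.mp hx)]

/-- By coercivity of the trace, the weight is dominated by a product of one-dimensional functions
`e^{-c'|x|}` of the upper entries. -/
theorem isFiniteMeasure_wishartBase {M : Matrix (Fin n) (Fin n) ℝ} (hM : M.PosDef) :
    IsFiniteMeasure (wishartBase M) := by
  obtain ⟨c, hc, h⟩ := exists_mul_sum_abs_le_trace hM
  set c' : ℝ := (n + 1) / 2 * c
  have hc' : 0 < c' := by positivity
  have hint : Integrable fun u : {p : Fin n × Fin n // p.1 ≤ p.2} → ℝ =>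
      ∏ p, Real.exp (-(c' * |u p|)) :=
    Integrable.fintype_prod fun _ => integrable_exp_neg_mul_abs hc'
  refine ⟨?_⟩
  rw [wishartBase, withDensity_apply _ MeasurableSet.univ, Measure.restrict_univ, symmVolume,
    lintegral_map (measurable_wishartWeight M) (measurable_symmOfUpper n)]
  refine (lintegral_mono fun u => ?_).trans_lt hint.lintegral_lt_top
  by_cases hS : (symmOfUpper n u).PosDef
  · rw [wishartWeight, Set.indicator_of_mem (s := {S : Matrix (Fin n) (Fin n) ℝ | S.PosDef}) hS]
    refine ENNReal.ofReal_le_ofReal ?_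
    rw [← Real.exp_sum, Real.exp_le_exp, Finset.sum_neg_distrib, neg_le_neg_iff,
      ← Finset.mul_sum, mul_assoc]
    refine mul_le_mul_of_nonneg_left ((mul_le_mul_of_nonneg_left ?_ hc.le).trans (h _ hS))
      (by positivity)
    rw [← Fintype.sum_prod_type' fun i j => |symmOfUpper n u i j|]
    calc ∑ p, |u p| = ∑ p : {p : Fin n × Fin n // p.1 ≤ p.2},
          |symmOfUpper n u p.1.1 p.1.2| := by simp_rw [symmOfUpper_apply]
      _ = ∑ p ∈ Finset.univ.filter (fun p : Fin n × Fin n => p.1 ≤ p.2),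
          |symmOfUpper n u p.1 p.2| :=
        (Finset.sum_subtype (p := fun p : Fin n × Fin n => p.1 ≤ p.2) _ (by simp)
          (fun p : Fin n × Fin n => |symmOfUpper n u p.1 p.2|)).symm
      _ ≤ ∑ p : Fin n × Fin n, |symmOfUpper n u p.1 p.2| :=
        Finset.sum_le_sum_of_subset_of_nonneg (Finset.subset_univ _) fun _ _ _ => abs_nonneg _
  · rw [wishartWeight, Set.indicator_of_notMem (s := {S : Matrix (Fin n) (Fin n) ℝ | S.PosDef}) hS]
    exact zero_le

theorem wishartPeak_self {M : Matrix (Fin n) (Fin n) ℝ} (hM : M.PosDef) : wishartPeak M M = 1 := by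
  rw [wishartPeak_of_posDef M hM,
    nonsing_inv_mul _ ((isUnit_iff_isUnit_det M).mp hM.isUnit)]
  simp

/-- In the coordinates of upper entries the set contains a neighbourhood of `M`, on which the weight
is positive; Lebesgue measure charges neighbourhoods. -/
theorem wishartBase_lt_wishartPeak_ne_zero {M : Matrix (Fin n) (Fin n) ℝ} (hM : M.PosDef) {a : ℝ}
    (ha : a < 1) : wishartBase M {S | a < wishartPeak M S} ≠ 0 := by
  set u₀ : {p : Fin n × Fin n // p.1 ≤ p.2} → ℝ := fun p => M p.1.1 p.1.2
  have hu₀ : symmOfUpper n u₀ = M := symmOfUpper_upper hM.1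
  have hs : MeasurableSet {S | a < wishartPeak M S} :=
    measurableSet_lt measurable_const (measurable_wishartPeak M)
  have hcont : Continuous fun S : Matrix (Fin n) (Fin n) ℝ =>
      (M⁻¹ * S).det * Real.exp (n - (M⁻¹ * S).trace) :=
    (continuous_const.matrix_mul continuous_id).matrix_det.mul
      (Real.continuous_exp.comp (continuous_const.sub (continuous_inv_mul_trace M)))
  have hev : ∀ᶠ S in 𝓝 M, a < (M⁻¹ * S).det * Real.exp (n - (M⁻¹ * S).trace) := by
    refine hcont.continuousAt.eventually (lt_mem_nhds ?_)
    have h1 := wishartPeak_self hM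
    rw [wishartPeak_of_posDef M hM] at h1
    exact ha.trans_eq h1.symm
  have hnhds : {u | (symmOfUpper n u).PosDef ∧ a < wishartPeak M (symmOfUpper n u)} ∈ 𝓝 u₀ := by
    have ht : Tendsto (symmOfUpper n) (𝓝 u₀) (𝓝 M) := by
      simpa [hu₀] using (continuous_symmOfUpper n).tendsto u₀
    filter_upwards [ht.eventually hM.eventually_posDef, ht.eventually hev] with u hu hu'
    have hp := hu (isHermitian_symmOfUpper u)
    exact ⟨hp, by rwa [wishartPeak_of_posDef M hp]⟩
  intro h0
  have hs' : MeasurableSet ({S | wishartWeight M S ≠ 0} ∩ {S | a < wishartPeak M S}) :=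
    (measurable_wishartWeight M (measurableSet_singleton 0).compl).inter hs
  rw [wishartBase, withDensity_apply_eq_zero (measurable_wishartWeight M), symmVolume,
    Measure.map_apply (measurable_symmOfUpper n) hs'] at h0
  refine (Measure.measure_pos_of_mem_nhds volume hnhds).ne' (measure_mono_null ?_ h0)
  rintro u ⟨hu, hu'⟩
  refine ⟨?_, hu'⟩
  change wishartWeight M (symmOfUpper n u) ≠ 0
  rw [wishartWeight, Set.indicator_of_mem (s := {S : Matrix (Fin n) (Fin n) ℝ | S.PosDef}) hu]
  exact (ENNReal.ofReal_pos.mpr (Real.exp_pos _)).ne'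

theorem posDef_smul_iff {r : ℝ} (hr : 0 < r) {S : Matrix (Fin n) (Fin n) ℝ} :
    (r • S).PosDef ↔ S.PosDef :=
  ⟨fun h => by simpa [smul_smul, hr.ne'] using h.smul (inv_pos.mpr hr), fun h => h.smul hr⟩

/-- The scaling by `ρ` puts the parameter into the exponent of the trace as well, so that
determinant and exponential form a single `k`-th power. The constant collects everything independent
of `S`. -/
theorem wishartDensity_smul {M : Matrix (Fin n) (Fin n) ℝ} (hM : M.PosDef) {ρ : ℝ} (hρ : n + 1 < ρ) :
    ∃ c : ℝ≥0∞, c ≠ 0 ∧ c ≠ ∞ ∧ ∀ S, wishartDensity M ρ (ρ • S) =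
      c * (wishartWeight M S * ENNReal.ofReal (wishartPeak M S ^ ((ρ - n - 1) / 2))) := by
  have hρ0 : 0 < ρ := by
    have : (0 : ℝ) ≤ n := n.cast_nonneg
    linarith
  set k := (ρ - n - 1) / 2 with hk
  have hMi := hM.inv.det_pos
  set c : ℝ := (ρ ^ n) ^ k * ((M⁻¹).det ^ k * Real.exp (n * k))⁻¹
  have hc : 0 < c := by positivity
  refine ⟨ENNReal.ofReal c, (ENNReal.ofReal_pos.mpr hc).ne', ENNReal.ofReal_ne_top, fun S => ?_⟩
  by_cases hS : S.PosDef
  · have hS' : (ρ • S).PosDef := (posDef_smul_iff hρ0).mpr hS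
    rw [wishartDensity, Set.indicator_of_mem (s := {S : Matrix (Fin n) (Fin n) ℝ | S.PosDef}) hS',
      wishartWeight, Set.indicator_of_mem (s := {S : Matrix (Fin n) (Fin n) ℝ | S.PosDef}) hS,
      wishartPeak_of_posDef M hS, ← ENNReal.ofReal_mul (Real.exp_pos _).le,
      ← ENNReal.ofReal_mul hc.le]
    congr 1
    have hSd := hS.det_pos
    rw [det_smul, Fintype.card_fin, det_mul, Real.mul_rpow (by positivity) (Real.exp_pos _).le,
      Real.mul_rpow (by positivity) hSd.le, Real.mul_rpow hMi.le hSd.le, ← Real.exp_mul,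
      Matrix.mul_smul, trace_smul, smul_eq_mul, ← hk]
    -- This splits `ρ/2 = (n+1)/2 + k`: the first part is the fixed weight, the second goes into the
    -- peak.
    have he : Real.exp (-(ρ * (M⁻¹ * S).trace) / 2) = (Real.exp (n * k))⁻¹ *
        (Real.exp (-((n + 1) / 2 * (M⁻¹ * S).trace)) *
          Real.exp ((n - (M⁻¹ * S).trace) * k)) := by
      rw [← Real.exp_neg, ← Real.exp_add, ← Real.exp_add]
      congr 1
      rw [hk]
      ring
    rw [he]
    have : (M⁻¹).det ^ k ≠ 0 := (Real.rpow_pos_of_pos hMi k).ne'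
    simp only [c]
    field_simp
  · have hS' : ¬ (ρ • S).PosDef := fun h => hS ((posDef_smul_iff hρ0).mp h)
    rw [wishartDensity, Set.indicator_of_notMem
      (s := {S : Matrix (Fin n) (Fin n) ℝ | S.PosDef}) hS', wishartWeight,
      Set.indicator_of_notMem (s := {S : Matrix (Fin n) (Fin n) ℝ | S.PosDef}) hS, zero_mul,
      mul_zero]

theorem measurable_wishartDensity (M : Matrix (Fin n) (Fin n) ℝ) (ρ : ℝ) :
    Measurable (wishartDensity M ρ) := by
  refine Measurable.indicator (Measurable.ennreal_ofReal ?_) (measurableSet_posDef n)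
  exact ((continuous_id.matrix_det.measurable).pow_const _).mul
    (((continuous_inv_mul_trace M).measurable.neg.div_const 2).exp)

/-- The unnormalised measures differ by the factor `c * d`, from the volume and the density, which
cancels on normalising. -/
theorem wishart_eq_map_powLaw {M : Matrix (Fin n) (Fin n) ℝ} (hM : M.PosDef) {ρ : ℝ}
    (hρ : n + 1 < ρ) : wishart M ρ =
      (powLaw (wishartBase M) (wishartPeak M) ((ρ - n - 1) / 2)).map (ρ • ·) := by
  have hρ0 : 0 < ρ := by
    have : (0 : ℝ) ≤ n := n.cast_nonneg
    linarith
  obtain ⟨c, hc0, hct, hc⟩ := symmVolume_map_smul (n := n) hρ0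
  obtain ⟨d, hd0, hdt, hd⟩ := wishartDensity_smul hM hρ
  set k := (ρ - n - 1) / 2
  have hm : Measurable fun S : Matrix (Fin n) (Fin n) ℝ => ρ • S :=
    (continuous_const_smul ρ).measurable
  have hpk : Measurable fun S => ENNReal.ofReal (wishartPeak M S ^ k) :=
    ((measurable_wishartPeak M).pow_const k).ennreal_ofReal
  have h : (symmVolume n).withDensity (wishartDensity M ρ) =
      (c * d) • (powDensity (wishartBase M) (wishartPeak M) k).map (ρ • ·) := by
    ext s hs
    rw [Measure.smul_apply, Measure.map_apply hm hs, powDensity, wishartBase,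
      ← withDensity_mul _ (measurable_wishartWeight M) hpk, withDensity_apply _ hs,
      withDensity_apply _ (hm hs)]
    conv_lhs => rw [hc]
    rw [Measure.restrict_smul, lintegral_smul_measure, ← lintegral_indicator hs,
      lintegral_map ((measurable_wishartDensity M ρ).indicator hs) hm, smul_eq_mul, smul_eq_mul,
      mul_assoc, ← lintegral_const_mul _ ((measurable_wishartWeight M).mul hpk),
      ← lintegral_indicator (hm hs)]
    congr 2
    ext S : 1
    by_cases hS : ρ • S ∈ s
    · rw [Set.indicator_of_mem hS, Set.indicator_of_mem (s := (ρ • ·) ⁻¹' s) hS, hd]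
      rfl
    · rw [Set.indicator_of_notMem hS, Set.indicator_of_notMem (s := (ρ • ·) ⁻¹' s) hS]
  have hcd0 : c * d ≠ 0 := mul_ne_zero hc0 hd0
  have hcdt : c * d ≠ ∞ := ENNReal.mul_ne_top hct hdt
  rw [wishart, h, powLaw, Measure.smul_apply, Measure.map_apply hm MeasurableSet.univ,
    Set.preimage_univ, smul_eq_mul, ENNReal.mul_inv (Or.inl hcd0) (Or.inl hcdt), smul_smul,
    mul_right_comm, ENNReal.inv_mul_cancel hcd0 hcdt, one_mul, Measure.map_smul]

theorem isProbabilityMeasure_wishart {M : Matrix (Fin n) (Fin n) ℝ} (hM : M.PosDef) {ρ : ℝ}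
    (hρ : n + 1 < ρ) : IsProbabilityMeasure (wishart M ρ) := by
  have := isFiniteMeasure_wishartBase hM
  have := isProbabilityMeasure_powLaw (measurable_wishartPeak M) (wishartPeak_nonneg hM)
    (wishartPeak_le_one hM) (fun a => wishartBase_lt_wishartPeak_ne_zero hM)
    (k := (ρ - n - 1) / 2) (by linarith)
  rw [wishart_eq_map_powLaw hM hρ]
  exact Measure.isProbabilityMeasure_map (continuous_const_smul ρ).measurable.aemeasurable

/-- Under `W(M, ρ)`, the rescaled matrix `S / ρ` concentrates at `M` as `ρ → ∞`. -/
theorem tendsto_integral_wishart {M : Matrix (Fin n) (Fin n) ℝ} (hM : M.PosDef)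
    {E : Type*} [NormedAddCommGroup E] [NormedSpace ℝ E] [CompleteSpace E]
    {G : ℝ → Matrix (Fin n) (Fin n) ℝ → E} {L : E} (hGm : ∀ ρ, StronglyMeasurable (G ρ)) {C : ℝ}
    (hG : ∀ ρ S, ‖G ρ S‖ ≤ C)
    (hL : Tendsto (fun p : ℝ × Matrix (Fin n) (Fin n) ℝ => G p.1 (p.1 • p.2))
      (atTop ×ˢ (𝓝 M ⊓ 𝓟 {S | S.PosDef})) (𝓝 L)) :
    Tendsto (fun ρ => ∫ S, G ρ S ∂(wishart M ρ)) atTop (𝓝 L) := by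
  have := isFiniteMeasure_wishartBase hM
  have hm (ρ : ℝ) : Measurable fun S : Matrix (Fin n) (Fin n) ℝ => ρ • S :=
    (continuous_const_smul ρ).measurable
  have hle : comap (wishartPeak M) (𝓝 1) ≤ 𝓝 M ⊓ 𝓟 {S | S.PosDef} :=
    le_inf (comap_wishartPeak_le hM) (le_principal_iff.mpr (eventually_posDef_comap_wishartPeak M))
  -- Inverse of `k = (ρ-n-1)/2`, used to reindex the family by `k`.
  have hρ : Tendsto (fun k : ℝ => 2 * k + n + 1) atTop atTop :=
    tendsto_atTop_add_const_right _ _ (tendsto_atTop_add_const_right _ _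
      (tendsto_id.const_mul_atTop zero_lt_two))
  have hlim := tendsto_integral_powLaw (measurable_wishartPeak M) (wishartPeak_nonneg hM)
    (wishartPeak_le_one hM) (fun a => wishartBase_lt_wishartPeak_ne_zero hM)
    (G := fun k S => G (2 * k + n + 1) ((2 * k + n + 1) • S)) (L := L)
    (fun k => (hGm _).comp_measurable (hm _)) (fun k S => hG _ _)
    (hL.comp (hρ.prodMap (tendsto_id.mono_right hle)))
  have hk : Tendsto (fun ρ : ℝ => (ρ - n - 1) / 2) atTop atTop :=
    (tendsto_atTop_add_const_right _ (-1 : ℝ) (tendsto_atTop_add_const_right _ (-n : ℝ)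
      tendsto_id)).atTop_div_const zero_lt_two
  refine (hlim.comp hk).congr' ?_
  filter_upwards [eventually_gt_atTop ((n : ℝ) + 1)] with ρ hρ
  rw [wishart_eq_map_powLaw hM hρ, integral_map (hm ρ).aemeasurable
    (hGm ρ).aestronglyMeasurable, Function.comp_apply,
    show 2 * ((ρ - n - 1) / 2) + n + 1 = ρ by ring]

end SymmVolume

/-! ### Characteristic functions of the marginals and their limits. -/

section Marginal

variable {n : ℕ}

theorem charFun_snd_compProd (μ : Measure (Matrix (Fin n) (Fin n) ℝ)) [IsProbabilityMeasure μ]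
    (c : ℝ) (t : EuclideanSpace ℝ (Fin n)) :
    charFun (μ ⊗ₘ gaussianKernel n c).snd t = ∫ S, charFun (gaussianKernel n c S) t ∂μ := by
  have hm : Measurable fun y : EuclideanSpace ℝ (Fin n) =>
      Complex.exp (inner ℝ y t * Complex.I) := by fun_prop
  simp_rw [charFun_apply]
  rw [Measure.snd, integral_map measurable_snd.aemeasurable hm.aestronglyMeasurable,
    Measure.integral_compProd]
  refine Integrable.of_bound (hm.comp measurable_snd).aestronglyMeasurable 1 (.of_forall fun p => ?_)
  simp [Complex.norm_exp]

theorem stronglyMeasurable_charFun_gaussianKernel (c : ℝ) (t : EuclideanSpace ℝ (Fin n)) :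
    StronglyMeasurable fun S => charFun (gaussianKernel n c S) t := by
  have hm : Measurable fun y : EuclideanSpace ℝ (Fin n) =>
      Complex.exp (inner ℝ y t * Complex.I) := by fun_prop
  simp_rw [charFun_apply]
  exact hm.stronglyMeasurable.integral_kernel

theorem charFun_multivariateGaussian_zero {S : Matrix (Fin n) (Fin n) ℝ} (hS : S.PosSemidef)
    (t : EuclideanSpace ℝ (Fin n)) :
    charFun (multivariateGaussian 0 S) t =
      Complex.exp (-((WithLp.ofLp t ⬝ᵥ S *ᵥ WithLp.ofLp t : ℝ) / 2)) := by
  rw [charFun_multivariateGaussian hS]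
  simp

/-- The explicit exponential is continuous in the covariance, but it is the characteristic function
only for positive semidefinite matrices; hence the eventual hypothesis. -/
theorem tendsto_charFun_multivariateGaussian {ι : Type*} {l : Filter ι}
    {S : ι → Matrix (Fin n) (Fin n) ℝ} {M : Matrix (Fin n) (Fin n) ℝ} (hM : M.PosSemidef)
    (hS : ∀ᶠ i in l, (S i).PosSemidef) (h : Tendsto S l (𝓝 M)) (t : EuclideanSpace ℝ (Fin n)) :
    Tendsto (fun i => charFun (multivariateGaussian 0 (S i)) t) l
      (𝓝 (charFun (multivariateGaussian 0 M) t)) := by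
  have hc : Continuous fun A : Matrix (Fin n) (Fin n) ℝ =>
      Complex.exp (-((WithLp.ofLp t ⬝ᵥ A *ᵥ WithLp.ofLp t : ℝ) / 2)) := by
    have : Continuous fun A : Matrix (Fin n) (Fin n) ℝ => WithLp.ofLp t ⬝ᵥ A *ᵥ WithLp.ofLp t :=
      continuous_const.dotProduct (continuous_id.matrix_mulVec continuous_const)
    fun_prop
  rw [charFun_multivariateGaussian_zero hM]
  refine ((hc.tendsto M).comp h).congr' ?_
  filter_upwards [hS] with i hi
  exact (charFun_multivariateGaussian_zero hi t).symm

/-- Lévy's continuity theorem along the reals. -/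
theorem convergesWeakly_of_tendsto_charFun {E : Type*} [NormedAddCommGroup E]
    [InnerProductSpace ℝ E] [FiniteDimensional ℝ E] [MeasurableSpace E] [BorelSpace E]
    {μ : ℝ → Measure E} {ν : Measure E} [IsProbabilityMeasure ν]
    (hμ : ∀ᶠ ρ in atTop, IsProbabilityMeasure (μ ρ))
    (h : ∀ t, Tendsto (fun ρ => charFun (μ ρ) t) atTop (𝓝 (charFun ν t))) :
    ConvergesWeakly μ ν := by
  refine ⟨hμ, fun f => tendsto_of_seq_tendsto fun u hu => ?_⟩
  obtain ⟨N, hN⟩ := eventually_atTop.mp (hu.eventually hμ)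
  -- Dropping the first `N` terms leaves a sequence consisting of probability measures only.
  rw [← tendsto_add_atTop_iff_nat N]
  have hu' : Tendsto (fun k => u (k + N)) atTop atTop := (tendsto_add_atTop_iff_nat N).mpr hu
  let P : ℕ → ProbabilityMeasure E := fun k => ⟨μ (u (k + N)), hN _ (Nat.le_add_left N k)⟩
  let Q : ProbabilityMeasure E := ⟨ν, inferInstance⟩
  have hPQ : Tendsto P atTop (𝓝 Q) :=
    ProbabilityMeasure.tendsto_of_tendsto_charFun fun t => (h t).comp hu'
  exact ProbabilityMeasure.tendsto_iff_forall_integral_tendsto.mp hPQ f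

/-- The factor `1/ρ` exactly undoes the rescaling, so the conditional covariance is itself the
concentrating matrix. -/
theorem convergesWeakly_pcaModel {q : ℕ} (X : Matrix (Fin n) (Fin q) ℝ) (σ : ℝ)
    (hM : (linearCov X (σ ^ 2)).PosDef) :
    ConvergesWeakly (fun ρ => (pcaModel X σ ρ).snd)
      (multivariateGaussian 0 (linearCov X (σ ^ 2))) := by
  have hprob : ∀ᶠ ρ : ℝ in atTop, IsProbabilityMeasure (wishart (linearCov X (σ ^ 2)) ρ) := by
    filter_upwards [eventually_gt_atTop ((n : ℝ) + 1)] with ρ hρ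
    exact isProbabilityMeasure_wishart hM hρ
  refine convergesWeakly_of_tendsto_charFun ?_ fun t => ?_
  · filter_upwards [hprob] with ρ hρ
    unfold pcaModel
    infer_instance
  · have h := tendsto_integral_wishart hM
      (G := fun ρ S => charFun (gaussianKernel n (1 / ρ) S) t)
      (fun ρ => stronglyMeasurable_charFun_gaussianKernel (1 / ρ) t)
      (fun ρ S => norm_charFun_le_one t)
      (L := charFun (multivariateGaussian 0 (linearCov X (σ ^ 2))) t) ?_
    · refine h.congr' ?_
      filter_upwards [hprob] with ρ hρ
      exact (charFun_snd_compProd _ _ t).symm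
    · have hsnd : Tendsto Prod.snd (atTop ×ˢ (𝓝 (linearCov X (σ ^ 2)) ⊓ 𝓟 {S | S.PosDef}))
          (𝓝 (linearCov X (σ ^ 2)) ⊓ 𝓟 {S | S.PosDef}) := tendsto_snd (f := (atTop : Filter ℝ))
      refine (tendsto_charFun_multivariateGaussian hM.posSemidef
        ((hsnd.eventually (mem_inf_of_right (mem_principal_self _))).mono fun p hp =>
          Matrix.PosDef.posSemidef hp) (hsnd.mono_right inf_le_left) t).congr' ?_
      filter_upwards [tendsto_fst.eventually (eventually_gt_atTop (0 : ℝ))] with p hp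
      change _ = charFun (multivariateGaussian 0 ((1 / p.1) • p.1 • p.2)) t
      rw [smul_smul, one_div, inv_mul_cancel₀ hp.ne', one_smul]

/-- Writing the Wishart matrix as `ρ • T`, the conditional covariance is `(1 + (1-n)/ρ) T⁻¹`, whose
scalar tends to 1 while `T` concentrates at `Ψ⁻¹`. -/
theorem convergesWeakly_mcaModel {q : ℕ} (X : Matrix (Fin n) (Fin q) ℝ) (β : ℝ)
    (hΨ : (linearCov X β).PosDef) :
    ConvergesWeakly (fun ρ => (mcaModel X β ρ).snd)
      (multivariateGaussian 0 (linearCov X β)) := by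
  set Ψ := linearCov X β with hΨdef
  have hM : Ψ⁻¹.PosDef := hΨ.inv
  have hinv : Ψ⁻¹⁻¹ = Ψ := nonsing_inv_nonsing_inv _ ((isUnit_iff_isUnit_det Ψ).mp hΨ.isUnit)
  have hprob : ∀ᶠ ρ : ℝ in atTop, IsProbabilityMeasure (invWishart Ψ ρ) := by
    filter_upwards [eventually_gt_atTop ((n : ℝ) + 1)] with ρ hρ
    have := isProbabilityMeasure_wishart hM hρ
    exact Measure.isProbabilityMeasure_map (measurable_inv_matrix n).aemeasurable
  refine convergesWeakly_of_tendsto_charFun ?_ fun t => ?_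
  · filter_upwards [hprob] with ρ hρ
    unfold mcaModel
    infer_instance
  · have h := tendsto_integral_wishart hM
      (G := fun ρ T => charFun (gaussianKernel n (ρ - n + 1) T⁻¹) t)
      (fun ρ => (stronglyMeasurable_charFun_gaussianKernel (ρ - n + 1) t).comp_measurable
        (measurable_inv_matrix n))
      (fun ρ S => norm_charFun_le_one t)
      (L := charFun (multivariateGaussian 0 Ψ) t) ?_
    · refine h.congr' ?_
      filter_upwards [hprob] with ρ hρ
      unfold mcaModel
      rw [charFun_snd_compProd, invWishart, integral_map (measurable_inv_matrix n).aemeasurable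
        (stronglyMeasurable_charFun_gaussianKernel _ t).aestronglyMeasurable]
    · have hsnd : Tendsto Prod.snd (atTop ×ˢ (𝓝 Ψ⁻¹ ⊓ 𝓟 {S | S.PosDef}))
          (𝓝 Ψ⁻¹ ⊓ 𝓟 {S | S.PosDef}) := tendsto_snd (f := (atTop : Filter ℝ))
      have hfst : Tendsto Prod.fst (atTop ×ˢ (𝓝 Ψ⁻¹ ⊓ 𝓟 {S : Matrix (Fin n) (Fin n) ℝ | S.PosDef}))
          (atTop : Filter ℝ) := tendsto_fst
      have hpd := hsnd.eventually (mem_inf_of_right (mem_principal_self _))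
      have hc : Tendsto (fun ρ : ℝ => 1 + (1 - n) * ρ⁻¹) atTop (𝓝 1) := by
        simpa using (tendsto_inv_atTop_zero.const_mul (1 - (n : ℝ))).const_add 1
      have hcpos : ∀ᶠ ρ : ℝ in atTop, 0 < 1 + (1 - n) * ρ⁻¹ :=
        hc.eventually (lt_mem_nhds zero_lt_one)
      -- Inversion is continuous where the determinant is nonzero, by the adjugate formula.
      have hi : ContinuousAt (fun S : Matrix (Fin n) (Fin n) ℝ => S⁻¹) Ψ⁻¹ := by
        have he : (fun S : Matrix (Fin n) (Fin n) ℝ => S⁻¹) = fun S => S.det⁻¹ • S.adjugate := by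
          ext1 S
          rw [Matrix.inv_def, Ring.inverse_eq_inv']
        rw [he]
        exact (ContinuousAt.inv₀ (continuous_id.matrix_det.continuousAt) hM.det_pos.ne').smul
          continuous_id.matrix_adjugate.continuousAt
      have hlim : Tendsto (fun p : ℝ × Matrix (Fin n) (Fin n) ℝ =>
          (1 + (1 - n) * p.1⁻¹) • p.2⁻¹) (atTop ×ˢ (𝓝 Ψ⁻¹ ⊓ 𝓟 {S | S.PosDef})) (𝓝 Ψ) := by
        have h1 := (hc.comp hfst).smul (hi.tendsto.comp (hsnd.mono_right inf_le_left))
        rwa [one_smul, hinv] at h1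
      refine (tendsto_charFun_multivariateGaussian hΨ.posSemidef ?_ hlim t).congr' ?_
      · filter_upwards [hpd, hfst.eventually hcpos] with p hp hp1
        exact ((Matrix.PosDef.inv hp).smul hp1).posSemidef
      · filter_upwards [hpd, hfst.eventually (eventually_gt_atTop (0 : ℝ))] with p hp hp1
        change _ = charFun (multivariateGaussian 0 ((p.1 - n + 1) • (p.1 • p.2)⁻¹)) t
        have hd : IsUnit p.2.det := isUnit_iff_ne_zero.mpr (Matrix.PosDef.det_pos hp).ne'
        have : (p.1 • p.2)⁻¹ = p.1⁻¹ • p.2⁻¹ :=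
          Matrix.inv_eq_right_inv (by
            rw [smul_mul_smul_comm, mul_nonsing_inv _ hd, mul_inv_cancel₀ hp1.ne', one_smul])
        rw [this, smul_smul]
        congr 3
        field_simp
        ring

end Marginal

/-! ### The limit as a noisy linear-kernel Gaussian process. -/

section GaussianProcess

variable {n q : ℕ}

theorem inner_toLp_mulVec (X : Matrix (Fin n) (Fin q) ℝ) (w : EuclideanSpace ℝ (Fin q))
    (t : EuclideanSpace ℝ (Fin n)) :
    inner ℝ (WithLp.toLp 2 (X *ᵥ WithLp.ofLp w) : EuclideanSpace ℝ (Fin n)) t =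
      inner ℝ w (WithLp.toLp 2 (Xᵀ *ᵥ WithLp.ofLp t)) := by
  simp only [EuclideanSpace.inner_eq_star_dotProduct, star_trivial]
  rw [dotProduct_mulVec, mulVec_transpose]

/-- Moving `X` across the inner product evaluates the standard Gaussian characteristic function at
`Xᵀt`, and `‖Xᵀt‖² = tᵀXXᵀt`. -/
theorem charFun_map_mulVec_stdGaussian (X : Matrix (Fin n) (Fin q) ℝ)
    (t : EuclideanSpace ℝ (Fin n)) :
    charFun ((stdGaussian (EuclideanSpace ℝ (Fin q))).map fun w =>
      (WithLp.toLp 2 (X *ᵥ WithLp.ofLp w) : EuclideanSpace ℝ (Fin n))) t =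
      Complex.exp (-((WithLp.ofLp t ⬝ᵥ (X * Xᵀ) *ᵥ WithLp.ofLp t : ℝ) / 2)) := by
  have hT : Continuous fun w : EuclideanSpace ℝ (Fin q) =>
      (WithLp.toLp 2 (X *ᵥ WithLp.ofLp w) : EuclideanSpace ℝ (Fin n)) :=
    (PiLp.continuous_toLp 2 _).comp
      (continuous_const.matrix_mulVec (PiLp.continuous_ofLp 2 _))
  rw [charFun_apply, integral_map hT.measurable.aemeasurable
    (Measurable.aestronglyMeasurable (by fun_prop))]
  simp_rw [inner_toLp_mulVec]
  rw [← charFun_apply, charFun_stdGaussian, ← Complex.ofReal_pow, ← real_inner_self_eq_norm_sq,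
    ← inner_toLp_mulVec, EuclideanSpace.inner_eq_star_dotProduct, star_trivial, mulVec_mulVec,
    neg_div]

/-- A noisy Gaussian process with linear kernel, observed at the rows of `X`, has law
`N(0, X Xᵀ + v I)`. -/
theorem isLinearGPLaw_multivariateGaussian (X : Matrix (Fin n) (Fin q) ℝ) {v : ℝ} (hv : 0 ≤ v)
    (hM : (linearCov X v).PosDef) :
    IsLinearGPLaw X v (multivariateGaussian 0 (linearCov X v)) := by
  set μ := stdGaussian (EuclideanSpace ℝ (Fin q))
  set N := multivariateGaussian (0 : EuclideanSpace ℝ (Fin n)) (v • (1 : Matrix (Fin n) (Fin n) ℝ))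
  have hvI : (v • (1 : Matrix (Fin n) (Fin n) ℝ)).PosSemidef := PosSemidef.one.smul hv
  have hfst : MeasurePreserving (Prod.fst : EuclideanSpace ℝ (Fin q) × EuclideanSpace ℝ (Fin n) → _)
    (μ.prod N) μ := measurePreserving_fst
  have hsnd : MeasurePreserving (Prod.snd : EuclideanSpace ℝ (Fin q) × EuclideanSpace ℝ (Fin n) → _)
    (μ.prod N) N := measurePreserving_snd
  -- A random linear functional: on the product space, `f x = ⟪x, w⟫` with `w` the standard Gaussian
  -- first coordinate, and the noise is the second coordinate.
  refine ⟨EuclideanSpace ℝ (Fin q) × EuclideanSpace ℝ (Fin n), inferInstance, μ.prod N,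
    fun x ω => inner ℝ x ω.1, Prod.snd, inferInstance, ?_, fun x => ?_, fun x x' => ?_,
    ⟨hsnd.measurable.aemeasurable, hsnd.map_eq⟩, ?_, ?_⟩
  · exact ⟨fun I => (HasLaw.hasGaussianLaw ⟨hfst.measurable.aemeasurable, hfst.map_eq⟩).map_fun
      (ContinuousLinearMap.pi fun x : I => innerSL ℝ (x : EuclideanSpace ℝ (Fin q)))⟩
  · have h := integral_map (f := fun w => inner ℝ x w)
      (hfst.measurable.aemeasurable (μ := μ.prod N))
      (Measurable.aestronglyMeasurable (by fun_prop))
    rw [hfst.map_eq] at h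
    exact h.symm.trans (integral_strongDual_stdGaussian (innerSL ℝ x))
  · have h := covariance_map_fun (μ := μ.prod N) (Z := Prod.fst) (X := fun w => inner ℝ x w)
      (Y := fun w => inner ℝ x' w) (Measurable.aestronglyMeasurable (by fun_prop))
      (Measurable.aestronglyMeasurable (by fun_prop)) measurable_fst.aemeasurable
    rw [← h, hfst.map_eq, ← covarianceBilin_apply_eq_cov IsGaussian.memLp_two_id,
      covarianceBilin_stdGaussian]
    rfl
  · exact (indepFun_prod (X := fun (w : EuclideanSpace ℝ (Fin q)) x => inner ℝ x w)
      (Y := fun e : EuclideanSpace ℝ (Fin n) => e) (by fun_prop) measurable_id)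
  · have hT : Measurable fun w : EuclideanSpace ℝ (Fin q) =>
        (WithLp.toLp 2 (X *ᵥ WithLp.ofLp w) : EuclideanSpace ℝ (Fin n)) :=
      ((PiLp.continuous_toLp 2 _).comp
        (continuous_const.matrix_mulVec (PiLp.continuous_ofLp 2 _))).measurable
    have hsum : (fun ω : EuclideanSpace ℝ (Fin q) × EuclideanSpace ℝ (Fin n) =>
        (WithLp.toLp 2 fun i => inner ℝ (WithLp.toLp 2 (X i)) ω.1 + ω.2 i :
          EuclideanSpace ℝ (Fin n))) =
        fun ω => (WithLp.toLp 2 (X *ᵥ WithLp.ofLp ω.1) : EuclideanSpace ℝ (Fin n)) + ω.2 := by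
      ext ω i
      simp [EuclideanSpace.inner_eq_star_dotProduct, mulVec, dotProduct_comm]
    have hTf : Measurable fun ω : EuclideanSpace ℝ (Fin q) × EuclideanSpace ℝ (Fin n) =>
        (WithLp.toLp 2 (X *ᵥ WithLp.ofLp ω.1) : EuclideanSpace ℝ (Fin n)) :=
      hT.comp measurable_fst
    rw [hsum]
    refine ⟨(hTf.add measurable_snd).aemeasurable, Measure.ext_of_charFun ?_⟩
    -- The observation is `X w + ε` with independent summands, so characteristic functions multiply
    -- and the covariances `X Xᵀ` and `v I` add.
    have hindep := indepFun_prod (μ := μ) (ν := N) hT measurable_id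
    have h := hindep.charFun_map_fun_add_eq_mul hTf.aemeasurable measurable_snd.aemeasurable
    refine h.trans ?_
    ext t
    have h1 : (μ.prod N).map (fun ω => (WithLp.toLp 2 (X *ᵥ WithLp.ofLp ω.1) :
        EuclideanSpace ℝ (Fin n))) = μ.map fun w => WithLp.toLp 2 (X *ᵥ WithLp.ofLp w) := by
      conv_rhs => rw [← hfst.map_eq]
      rw [Measure.map_map hT measurable_fst]
      rfl
    rw [Pi.mul_apply, h1, hsnd.map_eq, charFun_map_mulVec_stdGaussian, charFun_multivariateGaussian_zero hvI,
      charFun_multivariateGaussian_zero hM.posSemidef, ← Complex.exp_add, linearCov, add_mulVec,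
      dotProduct_add]
    congr 1
    push_cast
    ring

end GaussianProcess

end ProbDR

theorem mainTheorem7 (n q : ℕ) (X : Matrix (Fin n) (Fin q) ℝ) (σ β : ℝ)
    (hσ : (ProbDR.linearCov X (σ ^ 2)).PosDef)
    (hβ0 : 0 ≤ β) (hβ : (ProbDR.linearCov X β).PosDef) :
    (ProbDR.ConvergesWeakly (fun ρ => (ProbDR.pcaModel X σ ρ).snd)
        (multivariateGaussian 0 (ProbDR.linearCov X (σ ^ 2))) ∧
      ProbDR.IsLinearGPLaw X (σ ^ 2)
        (multivariateGaussian 0 (ProbDR.linearCov X (σ ^ 2)))) ∧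
    (ProbDR.ConvergesWeakly (fun ρ => (ProbDR.mcaModel X β ρ).snd)
        (multivariateGaussian 0 (ProbDR.linearCov X β)) ∧
      ProbDR.IsLinearGPLaw X β
        (multivariateGaussian 0 (ProbDR.linearCov X β))) := by
  exact ⟨⟨ProbDR.convergesWeakly_pcaModel X σ hσ,
      ProbDR.isLinearGPLaw_multivariateGaussian X (sq_nonneg σ) hσ⟩,
    ProbDR.convergesWeakly_mcaModel X β hβ, ProbDR.isLinearGPLaw_multivariateGaussian X hβ0 hβ⟩
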